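/- Let $K$ be a field, let $2\le t\le n$ be integers, and let $C_n$ be the cycle graph on the vertex set $\mathcal X=\{x_1,\dots,x_n\}$ (for $n=2$, a single edge). Let $\Delta=\Delta_t(C_n)$ be its path complex, i.e. the facet complex of the path ideal $I_t(C_n)\subseteq K[x_1,\dots,x_n]$ generated by the monomials $x_{i_1}\cdots x_{i_t}$ where $x_{i_1},\dots,x_{i_t}$ is a path in $C_n$ with $t$ distinct vertices; equivalently, $\Delta$ is the simplicial complex on $\mathcal X$ whose facets are the vertex sets of the paths of $C_n$ with exactly $t$ vertices. Let $\Delta_{\mathcal X}^c=\langle \mathcal X\setminus F : F \text{ a facet of } \Delta\rangle$ be the simplicial complex generated by the complements of the facets of $\Delta$ (it contains the empty face). Write $n=(t+1)p+d$ with integers $p\ge 0$ and $0\le d\le t$. Then for every integer $i$ the $i$-th reduced simplicial homology with coefficients in $K$ (where the empty face sits in degree $-1$) is $$\widetilde H_i(\Delta_{\mathcal X}^c)\cong\begin{cases}K^t & \text{if } d=0,\ i=2p-2,\ p>0,\\ K & \text{if } d\ne 0,\ i=2p-1,\\ 0 & \text{otherwise.}\end{cases}$$ -/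

import Mathlib

universe u v

namespace PathCycle

/-- A simplicial complex on (a subset of) `V`, the empty face included: a family of finite subsets
of `V` closed under passing to subsets. The complex `{∅}` and the void complex are distinguished.
Not every element of `V` has to be a vertex. -/
abbrev FaceFamily (V : Type v) := LowerSet (Finset V)

/-- The simplicial complex `⟨F | F ∈ S⟩`: its faces are all subsets of members of `S`. -/
def generatedBy {V : Type v} (S : Set (Finset V)) : FaceFamily V := lowerClosure S

/-- The facets of a simplicial complex: its maximal faces under inclusion. -/
def facets {V : Type v} (Δ : FaceFamily V) : Set (Finset V) := {F | Maximal (fun σ => σ ∈ Δ) F}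

/-- The complex `⟨Fᶜ | F a facet of Δ⟩`, with complements taken in the whole vertex set `V`. -/
def complementComplex {V : Type v} [Fintype V] [DecidableEq V] (Δ : FaceFamily V) : FaceFamily V :=
  generatedBy ((fun F => Fᶜ) '' facets Δ)

/-! ### Path ideals and path complexes -/

/-- The path ideal `I_t(G)`: generated by the monomials `x_{i_1} ⋯ x_{i_t}` over all paths
`i_1, …, i_t` of `G` with `t` (distinct) vertices. -/
noncomputable def pathIdeal (K : Type u) [Field K] {V : Type v} (G : SimpleGraph V) (t : ℕ) :
    Ideal (MvPolynomial V K) :=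
  Ideal.span {m | ∃ (x y : V) (w : G.Walk x y), w.IsPath ∧ w.length + 1 = t ∧
    m = (w.support.map MvPolynomial.X).prod}

/-- The facet complex of a square-free monomial ideal: it is generated by the vertex sets of the
minimal monomial generators, that is, of the minimal square-free monomials lying in the ideal. -/
noncomputable def facetComplex {K : Type u} [Field K] {V : Type v} (I : Ideal (MvPolynomial V K)) :
    FaceFamily V :=
  generatedBy {F | Minimal (fun σ : Finset V => ∏ x ∈ σ, MvPolynomial.X x ∈ I) F}

/-- The path complex `Δ_t(G)`: the facet complex of the path ideal `I_t(G)`. -/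
noncomputable def pathComplex (K : Type u) [Field K] {V : Type v} (G : SimpleGraph V) (t : ℕ) :
    FaceFamily V :=
  facetComplex (pathIdeal K G t)

/-! ### Reduced simplicial homology -/

section Homology

/-- The simplicial boundary map on the free module on all finite subsets of a linearly ordered set:
`{v₀ < ⋯ < v_k} ↦ ∑ j, (-1) ^ j • {v₀, …, v_k} \ {v_j}`, and `∅ ↦ 0`. -/
noncomputable def boundary (K : Type u) [Field K] (V : Type v) [LinearOrder V] :
    (Finset V →₀ K) →ₗ[K] (Finset V →₀ K) :=
  Finsupp.linearCombination K fun σ : Finset V =>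
    ∑ x ∈ σ, Finsupp.single (σ.erase x) ((-1 : K) ^ (σ.filter (· < x)).card)

/-- The reduced chains of degree `i`: linear combinations of the faces with `i + 1` vertices
(in degree `-1`, of the empty face). -/
noncomputable def chains (K : Type u) [Field K] {V : Type v} (Δ : FaceFamily V) (i : ℤ) :
    Submodule K (Finset V →₀ K) :=
  Finsupp.supported K K {σ | σ ∈ Δ ∧ (σ.card : ℤ) = i + 1}

variable (K : Type u) [Field K] {V : Type v} [LinearOrder V]

theorem boundary_single (σ : Finset V) (a : K) :
    boundary K V (Finsupp.single σ a) =
      ∑ x ∈ σ, Finsupp.single (σ.erase x) (a * (-1 : K) ^ (σ.filter (· < x)).card) := by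
  simp [boundary, Finset.smul_sum]

theorem boundary_mem (Δ : FaceFamily V) (i : ℤ) :
    ∀ c ∈ chains K Δ (i + 1), boundary K V c ∈ chains K Δ i := by
  intro c hc
  rw [boundary, Finsupp.linearCombination_apply]
  refine Submodule.sum_mem _ fun σ hσ => Submodule.smul_mem _ _ (Submodule.sum_mem _ fun x hx => ?_)
  obtain ⟨h1, h2⟩ := (Finsupp.mem_supported K c).1 hc hσ
  refine Finsupp.single_mem_supported K _ ⟨Δ.lower (Finset.erase_subset x σ) h1, ?_⟩
  have := Finset.card_erase_add_one hx
  omega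

theorem sign_swap {σ : Finset V} {x y : V} (hx : x ∈ σ) (hxy : x < y) :
    (-1 : K) ^ (σ.filter (· < x)).card * (-1 : K) ^ ((σ.erase x).filter (· < y)).card +
      (-1 : K) ^ (σ.filter (· < y)).card * (-1 : K) ^ ((σ.erase y).filter (· < x)).card = 0 := by
  have h1 : (σ.erase y).filter (· < x) = σ.filter (· < x) := by
    ext z
    simp only [Finset.mem_filter, Finset.mem_erase]
    exact ⟨fun h => ⟨h.1.2, h.2⟩, fun h => ⟨⟨(h.2.trans hxy).ne, h.1⟩, h.2⟩⟩
  have h2 : ((σ.erase x).filter (· < y)).card + 1 = (σ.filter (· < y)).card := by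
    rw [Finset.filter_erase]
    exact Finset.card_erase_add_one (Finset.mem_filter.2 ⟨hx, hxy⟩)
  rw [h1, ← h2]
  ring

theorem boundary_boundary (c : Finset V →₀ K) : boundary K V (boundary K V c) = 0 := by
  induction c using Finsupp.induction_linear with
  | zero => simp
  | add f g hf hg => simp [hf, hg]
  | single σ a =>
    simp only [boundary_single, map_sum]
    rw [Finset.sum_sigma']
    refine Finset.sum_involution (fun p _ => ⟨p.2, p.1⟩) ?_ ?_ ?_ ?_
    · rintro ⟨x, y⟩ h
      simp only [Finset.mem_sigma, Finset.mem_erase] at h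
      obtain ⟨hx, hyx, hy⟩ := h
      dsimp only
      rw [Finset.erase_right_comm, ← Finsupp.single_add, mul_assoc, mul_assoc, ← mul_add]
      rcases lt_or_gt_of_ne hyx with h | h
      · rw [add_comm, sign_swap K hy h, mul_zero, Finsupp.single_zero]
      · rw [sign_swap K hx h, mul_zero, Finsupp.single_zero]
    · rintro ⟨x, y⟩ h _ he
      simp only [Finset.mem_sigma, Finset.mem_erase] at h
      exact h.2.1 (congrArg Sigma.fst he)
    · rintro ⟨x, y⟩ h
      simp only [Finset.mem_sigma, Finset.mem_erase] at h ⊢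
      exact ⟨h.2.2, h.2.1.symm, h.1⟩
    · rintro ⟨x, y⟩ _
      rfl

/-- The reduced chain complex of a simplicial complex on a linearly ordered set, with coefficients
in `K`, indexed by all integers. -/
noncomputable def reducedChainComplex (Δ : FaceFamily V) : ChainComplex (ModuleCat.{max u v} K) ℤ :=
  ChainComplex.of (fun i => ModuleCat.of K (chains K Δ i))
    (fun i => ModuleCat.ofHom ((boundary K V).restrict (boundary_mem K Δ i)))
    (fun _ => ModuleCat.hom_ext <| LinearMap.ext fun c =>
      Subtype.ext (boundary_boundary K (c : Finset V →₀ K)))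

/-- The `i`-th reduced homology of a simplicial complex with coefficients in `K`. -/
noncomputable abbrev reducedHomology (Δ : FaceFamily V) (i : ℤ) : ModuleCat.{max u v} K :=
  (reducedChainComplex K Δ).homology i

end Homology

end PathCycle

namespace PathCycle

/-! The non-faces of the complement complex are the vertex sets that meet every cyclic interval of
`t` consecutive vertices (`notMem_complementComplex_cycleGraph_iff`). Since the full simplex is
acyclic, homology in degree `i` is the relative homology in degree `i + 1`, carried by these dense
sets. A discrete Morse matching on them leaves few critical sets.

Label the vertices `0, …, n - 1` and let `b` be the number of vertices beyond the largest element of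
a dense set `s`. Compare `s` with the sequence `0, t - b, t + 1, (t + 1) + (t - b), …`. At the first
mark that `s` does not follow, either the mark is missing or another element lies before the next
mark. If that mark is below the largest element, density gives such an element even when the mark is
missing, and this element makes the mark redundant for density. So the mark can be toggled
(`IsDense.toggle_pivotMark`). The largest element and the number of marks followed determine the
mark, do not change under toggling, and order the sets into monotone levels, so the matching is
acyclic.

The critical sets are the initial segments of mark sequences whose last mark is `n - 1 - b`
(`dense_critical_iff`). Arithmetic modulo `t + 1` gives one for each `b < t`, of size `2p`, if `d =
0`, and a single one, of size `2p + 1`, if `d ≠ 0` (`mark_add_eq_iff`). As all have the same size,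
homology vanishes outside one degree (`LayeredMatching.subsingleton_reducedHomology`), and the Euler
characteristic gives the dimension there (`LayeredMatching.finrank_reducedHomology`), so no Morse
differential is needed. -/

theorem mem_chains_iff {K : Type u} [Field K] {V : Type v} {Δ : FaceFamily V} {i : ℤ} {c : Finset V →₀ K} :
    c ∈ chains K Δ i ↔ ∀ σ, c σ ≠ 0 → σ ∈ Δ ∧ (σ.card : ℤ) = i + 1 := by
  rw [chains, Finsupp.mem_supported]
  simp [Set.subset_def]

/-! ### Layered matchings on upper sets of finite sets -/

section LayeredMatching

variable {V : Type v} [LinearOrder V]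

/-- Add `x` to a finite set, or remove it if it is already there. -/
def toggle (x : V) (σ : Finset V) : Finset V := if x ∈ σ then σ.erase x else insert x σ

theorem toggle_of_mem {x : V} {σ : Finset V} (h : x ∈ σ) : toggle x σ = σ.erase x := if_pos h

theorem toggle_of_notMem {x : V} {σ : Finset V} (h : x ∉ σ) : toggle x σ = insert x σ := if_neg h

theorem toggle_toggle (x : V) (σ : Finset V) : toggle x (toggle x σ) = σ := by
  by_cases h : x ∈ σ
  · rw [toggle_of_mem h, toggle_of_notMem (Finset.notMem_erase x σ), Finset.insert_erase h]
  · rw [toggle_of_notMem h, toggle_of_mem (Finset.mem_insert_self x σ), Finset.erase_insert h]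

theorem toggle_ne (x : V) (σ : Finset V) : toggle x σ ≠ σ := by
  by_cases h : x ∈ σ
  · rw [toggle_of_mem h]; exact fun e => Finset.erase_eq_self.1 e h
  · rw [toggle_of_notMem h]; exact fun e => h (Finset.insert_eq_self.1 e)

theorem neg_one_pow_card_toggle (x : V) (σ : Finset V) :
    (-1 : ℤ) ^ (toggle x σ).card = -(-1) ^ σ.card := by
  by_cases h : x ∈ σ
  · rw [toggle_of_mem h, ← Finset.card_erase_add_one h, pow_succ]; simp
  · rw [toggle_of_notMem h, Finset.card_insert_of_notMem h, pow_succ]; simp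

/-- An acyclic matching on an upper set `U` of finite sets. The sets in `U` are sorted into levels,
monotone under inclusion, and on each level the noncritical sets are matched by adding or removing
one and the same vertex. -/
structure LayeredMatching (U critical : Set (Finset V)) where
  /-- The level of a set. -/
  level : Finset V → ℕ
  /-- The vertex that is added to or removed from a noncritical set. -/
  pivot : Finset V → V
  isUpperSet : IsUpperSet U
  level_mono : ∀ {σ τ}, τ ∈ U → τ ⊆ σ → level τ ≤ level σ
  pivot_congr : ∀ {σ τ}, σ ∈ U → τ ∈ U → level σ = level τ → pivot σ = pivot τ
  toggle_mem : ∀ {σ}, σ ∈ U → σ ∉ critical → toggle (pivot σ) σ ∈ U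
  level_toggle : ∀ {σ}, σ ∈ U → σ ∉ critical → level (toggle (pivot σ) σ) = level σ
  toggle_notMem_critical : ∀ {σ}, σ ∈ U → σ ∉ critical → toggle (pivot σ) σ ∉ critical

/-- The matching on the full simplex that adds or removes a given vertex. -/
def LayeredMatching.univ (x : V) : LayeredMatching (Set.univ : Set (Finset V)) ∅ where
  level _ := 0
  pivot _ := x
  isUpperSet := isUpperSet_univ
  level_mono _ _ := le_rfl
  pivot_congr _ _ _ := rfl
  toggle_mem _ _ := trivial
  level_toggle _ _ := rfl
  toggle_notMem_critical _ _ := id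

variable (K : Type u) [Field K] [Fintype V]

theorem boundary_apply (c : Finset V →₀ K) (τ : Finset V) :
    boundary K V c τ = ∑ y ∈ τᶜ, c (insert y τ) * (-1 : K) ^ (τ.filter (· < y)).card := by
  induction c using Finsupp.induction_linear with
  | zero => simp
  | add f g hf hg => simp [hf, hg, add_mul, Finset.sum_add_distrib]
  | single σ a =>
    rw [boundary_single, Finsupp.finsetSum_apply]
    have key : ∀ (s : Finset V) (f : V → K), ∑ x ∈ s, f x = ∑ x, if x ∈ s then f x else 0 := by
      intro s f; simp [Finset.sum_ite_mem]
    rw [key σ, key τᶜ]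
    refine Finset.sum_congr rfl fun x _ => ?_
    simp only [Finsupp.single_apply, Finset.mem_compl]
    by_cases h : x ∈ σ ∧ σ.erase x = τ
    · obtain ⟨h1, rfl⟩ := h
      rw [Finset.insert_erase h1]
      have : (σ.erase x).filter (· < x) = σ.filter (· < x) := by
        ext z
        simp only [Finset.mem_filter, Finset.mem_erase]
        exact ⟨fun h => ⟨h.1.2, h.2⟩, fun h => ⟨⟨h.2.ne, h.1⟩, h.2⟩⟩
      simp [h1, this]
    · have h' : ¬ (x ∉ τ ∧ σ = insert x τ) := by
        rintro ⟨h1, rfl⟩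
        exact h ⟨Finset.mem_insert_self x τ, Finset.erase_insert h1⟩
      by_cases h1 : x ∈ σ <;> by_cases h2 : x ∈ τ <;> simp_all

variable {K}

/-- A chain whose boundary vanishes on `U` agrees on `U` with a boundary, as long as its degree is
not that of a critical set. -/
theorem LayeredMatching.exists_boundary {U C : Set (Finset V)} (m : LayeredMatching U C) {i : ℤ}
    (hC : ∀ σ ∈ U, σ ∈ C → (σ.card : ℤ) ≠ i + 1) {w : Finset V →₀ K} (hw : w ∈ chains K ⊤ i)
    (hwU : ∀ τ ∈ U, boundary K V w τ = 0) :
    ∃ u ∈ chains K (⊤ : FaceFamily V) (i + 1), ∀ τ ∈ U, (w - boundary K V u) τ = 0 := by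
  classical
  obtain ⟨N, hN⟩ : ∃ N, ∀ τ ∈ U, w τ ≠ 0 → m.level τ < N :=
    ⟨(Finset.univ.sup m.level) + 1, fun τ _ _ =>
      Nat.lt_succ_of_le (Finset.le_sup (f := m.level) (Finset.mem_univ τ))⟩
  -- Induction on a strict bound for the levels on which `w` is nonzero in `U`: the highest level is
  -- cleared by subtracting a boundary.
  induction N generalizing w with
  | zero =>
    refine ⟨0, Submodule.zero_mem _, fun τ hτ => ?_⟩
    by_contra h
    exact absurd (hN τ hτ (by simpa using h)) (Nat.not_lt_zero _)
  | succ N ih =>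
    -- For `τ` on level `N` without its pivot, the coefficient of `u` at `τ` with the pivot added is
    -- chosen so that its boundary term at `τ` equals `w τ`.
    let u : Finset V →₀ K := Finsupp.equivFunOnFinite.symm fun σ =>
      if σ ∈ U ∧ m.level σ = N ∧ (σ.card : ℤ) = i + 2 ∧ m.pivot σ ∈ σ then
        w (σ.erase (m.pivot σ)) *
          (-1 : K) ^ ((σ.erase (m.pivot σ)).filter (· < m.pivot σ)).card
      else 0
    have hu : ∀ σ, u σ ≠ 0 →
        σ ∈ U ∧ m.level σ = N ∧ (σ.card : ℤ) = i + 2 ∧ m.pivot σ ∈ σ := by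
      intro σ h
      by_contra h'
      exact h (if_neg h')
    have hu1 : u ∈ chains K (⊤ : FaceFamily V) (i + 1) :=
      mem_chains_iff.2 fun σ h => ⟨trivial, by rw [(hu σ h).2.2.1]; ring⟩
    have hw' : w - boundary K V u ∈ chains K ⊤ i :=
      Submodule.sub_mem _ hw (boundary_mem K ⊤ i u hu1)
    have hle : ∀ τ ∈ U, (w - boundary K V u) τ ≠ 0 → m.level τ ≤ N := by
      intro τ hτ h
      by_cases h1 : w τ = 0
      · have h2 : boundary K V u τ ≠ 0 := by
          intro h2; exact h (by simp [h1, h2])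
        rw [boundary_apply] at h2
        obtain ⟨y, -, hy⟩ := Finset.exists_ne_zero_of_sum_ne_zero h2
        have := hu _ (left_ne_zero_of_mul hy)
        rw [← this.2.1]
        exact m.level_mono hτ (Finset.subset_insert y τ)
      · exact Nat.lt_succ_iff.1 (hN τ hτ h1)
    have hcard : ∀ τ, (w - boundary K V u) τ ≠ 0 → (τ.card : ℤ) = i + 1 :=
      fun τ h => (mem_chains_iff.1 hw' τ h).2
    have hnot : ∀ τ ∈ U, m.level τ = N → m.pivot τ ∉ τ → (w - boundary K V u) τ = 0 := by
      intro τ hτ hl hx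
      by_contra h
      have hc := hcard τ h
      have hnc : τ ∉ C := fun h' => hC τ hτ h' hc
      have e := toggle_of_notMem hx
      have h1 := m.toggle_mem hτ hnc
      have h2 := m.level_toggle hτ hnc
      rw [e] at h1 h2
      have h3 : m.pivot (insert (m.pivot τ) τ) = m.pivot τ := m.pivot_congr h1 hτ h2
      apply h
      rw [Finsupp.sub_apply, boundary_apply, Finset.sum_eq_single (m.pivot τ)]
      · have : u (insert (m.pivot τ) τ) =
            w τ * (-1 : K) ^ (τ.filter (· < m.pivot τ)).card := by
          refine (if_pos ⟨h1, h2.trans hl, ?_, ?_⟩).trans ?_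
          · rw [h3, Finset.erase_insert hx]
          · rw [Finset.card_insert_of_notMem hx]; push_cast; rw [hc]; ring
          · rw [h3]; exact Finset.mem_insert_self _ _
        rw [this, mul_assoc, ← pow_add, ← two_mul, pow_mul]
        simp
      · intro y hy hne
        by_contra h4
        obtain ⟨a1, a2, -, a4⟩ := hu _ (left_ne_zero_of_mul h4)
        rw [m.pivot_congr a1 hτ (a2.trans hl.symm), Finset.mem_insert] at a4
        exact a4.elim (fun h => hne h.symm) hx
      · intro h4
        exact absurd (Finset.mem_compl.2 hx) h4
    have hlt : ∀ τ ∈ U, (w - boundary K V u) τ ≠ 0 → m.level τ < N := by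
      intro τ hτ h
      refine lt_of_le_of_ne (hle τ hτ h) fun hl => ?_
      by_cases hx : m.pivot τ ∈ τ
      · have hnc : τ ∉ C := fun h' => hC τ hτ h' (hcard τ h)
        have h1 := m.toggle_mem hτ hnc
        have h2 := m.level_toggle hτ hnc
        rw [toggle_of_mem hx] at h1 h2
        -- Read the boundary at `τ` minus its pivot. Every other set obtained by adding a vertex
        -- lacks the pivot and has level at least `N`; its coefficient vanishes by `hle` above level
        -- `N` and by `hnot` on it. Only the coefficient at `τ` is left.
        have hb : boundary K V (w - boundary K V u) (τ.erase (m.pivot τ)) = 0 := by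
          rw [map_sub, boundary_boundary, sub_zero]
          exact hwU _ h1
        rw [boundary_apply, Finset.sum_eq_single (m.pivot τ)] at hb
        · rw [Finset.insert_erase hx] at hb
          exact (mul_ne_zero h (pow_ne_zero _ (neg_ne_zero.2 one_ne_zero))) hb
        · intro y hy hne
          rw [mul_eq_zero]
          left
          by_contra h4
          have a1 : insert y (τ.erase (m.pivot τ)) ∈ U :=
            m.isUpperSet (Finset.subset_insert _ _) h1
          have a2 : m.level (insert y (τ.erase (m.pivot τ))) = N := by
            refine le_antisymm (hle _ a1 h4) ?_
            rw [← hl, ← h2]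
            exact m.level_mono h1 (Finset.subset_insert _ _)
          refine h4 (hnot _ a1 a2 ?_)
          rw [m.pivot_congr a1 hτ (a2.trans hl.symm)]
          simp [hne.symm]
        · intro h4
          exact absurd (Finset.mem_compl.2 (Finset.notMem_erase _ _)) h4
      · exact h (hnot τ hτ hl hx)
    obtain ⟨u', hu', h'⟩ := ih hw' (fun τ hτ => by
      rw [map_sub, boundary_boundary, sub_zero]; exact hwU τ hτ) hlt
    refine ⟨u + u', Submodule.add_mem _ hu1 hu', fun τ hτ => ?_⟩
    rw [map_add, ← sub_sub]
    exact h' τ hτ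

/-- Cycles of a simplicial complex are boundaries if the sets outside of the complex carry a
layered matching without critical sets of the relevant size. -/
theorem LayeredMatching.exists_boundary_eq [Nonempty V] {Δ : FaceFamily V} {C : Set (Finset V)}
    (m : LayeredMatching {σ | σ ∉ Δ} C) {i : ℤ}
    (hC : ∀ σ ∉ Δ, σ ∈ C → (σ.card : ℤ) ≠ i + 2) {z : Finset V →₀ K} (hz : z ∈ chains K Δ i)
    (hz0 : boundary K V z = 0) : ∃ v ∈ chains K Δ (i + 1), boundary K V v = z := by
  -- First fill `z` in the full simplex. The filling `w` is a relative cycle because `z` is zero on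
  -- non-faces; subtracting a boundary then pushes it into `Δ`.
  obtain ⟨w, hw, h⟩ := (LayeredMatching.univ (Classical.arbitrary V)).exists_boundary (i := i)
    (by simp) (w := z) (mem_chains_iff.2 fun σ h => ⟨trivial, (mem_chains_iff.1 hz σ h).2⟩)
    (by simp [hz0])
  have hwz : boundary K V w = z := by
    ext τ
    exact (sub_eq_zero.1 (by simpa using h τ trivial)).symm
  obtain ⟨u, hu, h'⟩ := m.exists_boundary (i := i + 1)
    (fun σ hσ hc => by rw [add_assoc]; exact hC σ hσ hc) hw (fun τ hτ => by
      by_contra h0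
      rw [hwz] at h0
      exact hτ (mem_chains_iff.1 hz τ h0).1)
  refine ⟨w - boundary K V u, mem_chains_iff.2 fun σ hσ => ⟨?_, ?_⟩, ?_⟩
  · by_contra hn
    exact hσ (h' σ hn)
  · exact (mem_chains_iff.1 (Submodule.sub_mem _ hw (boundary_mem K ⊤ (i + 1) u hu)) σ hσ).2
  · rw [map_sub, boundary_boundary, sub_zero, hwz]

/-- Toggling the pivot is a sign-reversing involution on the noncritical sets. -/
theorem LayeredMatching.sum_neg_one_pow_card {U C : Set (Finset V)} [DecidablePred (· ∈ U)]
    [DecidablePred (· ∈ C)] (m : LayeredMatching U C) :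
    ∑ σ with σ ∈ U, (-1 : ℤ) ^ σ.card = ∑ σ with σ ∈ U ∧ σ ∈ C, (-1 : ℤ) ^ σ.card := by
  rw [← Finset.sum_filter_add_sum_filter_not _ (· ∈ C), Finset.filter_filter,
    Finset.filter_filter, add_eq_left]
  refine Finset.sum_involution (fun σ _ => toggle (m.pivot σ) σ) ?_ ?_ ?_ ?_
  · intro σ _
    rw [neg_one_pow_card_toggle, add_neg_cancel]
  · intro σ _ _
    exact toggle_ne _ _
  · intro σ h
    simp only [Finset.mem_filter, Finset.mem_univ, true_and] at h ⊢
    exact ⟨m.toggle_mem h.1 h.2, m.toggle_notMem_critical h.1 h.2⟩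
  · intro σ h
    simp only [Finset.mem_filter, Finset.mem_univ, true_and] at h
    rw [m.pivot_congr (m.toggle_mem h.1 h.2) h.1 (m.level_toggle h.1 h.2), toggle_toggle]

end LayeredMatching

/-! ### Homology of complexes of vector spaces and rank counting -/

section ChainComplex

open CategoryTheory

universe w

variable {K : Type u} [Field K] (C : ChainComplex (ModuleCat.{w} K) ℤ)

theorem range_d_le_ker_d (i : ℤ) :
    LinearMap.range (C.d (i + 1 + 1) (i + 1)).hom ≤ LinearMap.ker (C.d (i + 1) i).hom := by
  rintro _ ⟨c, rfl⟩
  rw [LinearMap.mem_ker, ← LinearMap.comp_apply, ← ModuleCat.hom_comp, C.d_comp_d]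
  rfl

/-- The homology of a chain complex of vector spaces as cycles modulo boundaries. -/
theorem nonempty_homology_equiv (i : ℤ) :
    Nonempty (C.homology (i + 1) ≃ₗ[K] LinearMap.ker (C.d (i + 1) i).hom ⧸
      (LinearMap.range (C.d (i + 1 + 1) (i + 1)).hom).submoduleOf
        (LinearMap.ker (C.d (i + 1) i).hom)) := by
  let e : C.homology (i + 1) ≅ (C.sc' (i + 1 + 1) (i + 1) i).moduleCatLeftHomologyData.H :=
    C.homologyIsoSc' (i + 1 + 1) (i + 1) i (by simp) (by simp) ≪≫
      (C.sc' (i + 1 + 1) (i + 1) i).moduleCatHomologyIso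
  refine ⟨e.toLinearEquiv.trans (Submodule.quotEquivOfEq _ _ ?_)⟩
  ext ⟨x, hx⟩
  exact exists_congr fun y => Subtype.ext_iff

/-- The rank of the differential from degree `i + 1` to degree `i`. -/
noncomputable def differentialRank (i : ℤ) : ℕ :=
  Module.finrank K (LinearMap.range (C.d (i + 1) i).hom)

variable [∀ i, Module.Finite K (C.X i)]

theorem finite_homology (i : ℤ) : Module.Finite K (C.homology i) := by
  obtain ⟨j, rfl⟩ : ∃ j, i = j + 1 := ⟨i - 1, by ring⟩
  obtain ⟨e⟩ := nonempty_homology_equiv C j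
  exact Module.Finite.equiv e.symm

theorem finrank_homology_add (i : ℤ) :
    Module.finrank K (C.homology (i + 1)) + differentialRank C (i + 1) + differentialRank C i =
      Module.finrank K (C.X (i + 1)) := by
  obtain ⟨e⟩ := nonempty_homology_equiv C i
  have h := range_d_le_ker_d C i
  rw [differentialRank, differentialRank, e.finrank_eq,
    ← (Submodule.submoduleOfEquivOfLe h).finrank_eq, Submodule.finrank_quotient_add_finrank,
    add_comm]
  exact LinearMap.finrank_range_add_finrank_ker _

end ChainComplex

theorem reducedChainComplex_d (K : Type u) [Field K] {V : Type v} [LinearOrder V]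
    (Δ : FaceFamily V) (i : ℤ) : (reducedChainComplex K Δ).d (i + 1) i =
      ModuleCat.ofHom ((boundary K V).restrict (boundary_mem K Δ i)) :=
  ChainComplex.of_d (fun i => ModuleCat.of K (chains K Δ i))
    (fun i => ModuleCat.ofHom ((boundary K V).restrict (boundary_mem K Δ i))) i

/-! ### Euler characteristic and the dimension of reduced homology -/

section Finrank

variable (K : Type u) [Field K] {V : Type v}

theorem subsingleton_chains {Δ : FaceFamily V} {i : ℤ}
    (h : ∀ σ ∈ Δ, (σ.card : ℤ) ≠ i + 1) : Subsingleton (chains K Δ i) := by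
  have key : ∀ c : chains K Δ i, c = 0 := by
    intro c
    ext σ
    by_contra h0
    have := mem_chains_iff.1 c.2 σ h0
    exact h σ this.1 this.2
  exact ⟨fun a b => (key a).trans (key b).symm⟩

variable [Fintype V]

theorem finrank_chains (Δ : FaceFamily V) [DecidablePred (· ∈ Δ)] (j : ℕ) :
    Module.finrank K (chains K Δ ((j : ℤ) - 1)) =
      ((Finset.univ.filter (· ∈ Δ)).filter (·.card = j)).card := by
  rw [chains, (Finsupp.supportedEquivFinsupp _).finrank_eq, Module.finrank_finsupp_self,
    Fintype.card_subtype, Finset.filter_filter]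
  congr 1
  ext σ
  simp

variable [LinearOrder V]

instance (Δ : FaceFamily V) (i : ℤ) : Module.Finite K ((reducedChainComplex K Δ).X i) :=
  inferInstanceAs (Module.Finite K (chains K Δ i))

instance (Δ : FaceFamily V) (i : ℤ) : Module.Finite K (reducedHomology K Δ i) :=
  finite_homology _ i

/-- The reduced Euler characteristic computed from faces and from homology. -/
theorem sum_neg_one_pow_card_eq_sum_finrank (Δ : FaceFamily V) [DecidablePred (· ∈ Δ)] :
    ∑ σ with σ ∈ Δ, (-1 : ℤ) ^ σ.card = ∑ j ∈ Finset.range (Fintype.card V + 1),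
      (-1 : ℤ) ^ j * Module.finrank K (reducedHomology K Δ ((j : ℤ) - 1)) := by
  -- Indexed so that `β j` is the rank of the differential leaving the chains on `j`-element faces.
  -- These ranks telescope in the alternating sum, and both end terms vanish.
  let β : ℕ → ℤ := fun j => differentialRank (reducedChainComplex K Δ) ((j : ℤ) - 1 - 1)
  have h1 : ∀ j : ℕ, (Module.finrank K ((reducedChainComplex K Δ).X ((j : ℤ) - 1)) : ℤ) =
      Module.finrank K (reducedHomology K Δ ((j : ℤ) - 1)) + β (j + 1) + β j := by
    intro j
    have h := finrank_homology_add (reducedChainComplex K Δ) ((j : ℤ) - 1 - 1)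
    have e1 : (j : ℤ) - 1 - 1 + 1 = j - 1 := by ring
    have e2 : ((j + 1 : ℕ) : ℤ) - 1 - 1 = j - 1 := by push_cast; ring
    simp only [β, e2]
    rw [e1] at h
    exact_mod_cast h.symm
  have h0 : β 0 = 0 := by
    have := subsingleton_chains K (Δ := Δ) (i := ((0 : ℕ) : ℤ) - 1 - 1)
      (fun σ _ => by push_cast; omega)
    have : Subsingleton ((reducedChainComplex K Δ).X (((0 : ℕ) : ℤ) - 1 - 1)) := this
    simp only [β, differentialRank, Nat.cast_eq_zero]
    exact Module.finrank_zero_of_subsingleton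
  have hN : β (Fintype.card V + 1) = 0 := by
    have := subsingleton_chains K (Δ := Δ)
      (i := ((Fintype.card V + 1 : ℕ) : ℤ) - 1 - 1 + 1)
      (fun σ _ => by have := σ.card_le_univ; push_cast; omega)
    have h := LinearMap.finrank_range_le ((reducedChainComplex K Δ).d
      (((Fintype.card V + 1 : ℕ) : ℤ) - 1 - 1 + 1) (((Fintype.card V + 1 : ℕ) : ℤ) - 1 - 1)).hom
    have h0 : Module.finrank K ((reducedChainComplex K Δ).X
        (((Fintype.card V + 1 : ℕ) : ℤ) - 1 - 1 + 1)) = 0 :=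
      Module.finrank_zero_of_subsingleton (M := chains K Δ _)
    rw [h0] at h
    simp only [β, differentialRank, Nat.cast_eq_zero]
    exact Nat.le_zero.1 h
  have h2 : ∀ N : ℕ, ∑ j ∈ Finset.range N, (-1 : ℤ) ^ j * (β (j + 1) + β j) =
      -(-1) ^ N * β N := by
    intro N
    induction N with
    | zero => simp [h0]
    | succ N ih => rw [Finset.sum_range_succ, ih, pow_succ]; ring
  have h3 : ∑ σ with σ ∈ Δ, (-1 : ℤ) ^ σ.card = ∑ j ∈ Finset.range (Fintype.card V + 1),
      (-1 : ℤ) ^ j * Module.finrank K ((reducedChainComplex K Δ).X ((j : ℤ) - 1)) := by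
    rw [← Finset.sum_fiberwise_of_maps_to (s := Finset.univ.filter (· ∈ Δ))
      (t := Finset.range (Fintype.card V + 1)) (g := Finset.card)
      (fun σ _ => Finset.mem_range.2 (Nat.lt_succ_of_le σ.card_le_univ))]
    refine Finset.sum_congr rfl fun j _ => ?_
    have h : Module.finrank K ((reducedChainComplex K Δ).X ((j : ℤ) - 1)) = _ :=
      finrank_chains K Δ j
    rw [h, Finset.sum_congr rfl (fun σ hσ => by rw [(Finset.mem_filter.1 hσ).2]),
      Finset.sum_const, nsmul_eq_mul, mul_comm]
  rw [h3, ← add_zero (∑ j ∈ _, (-1 : ℤ) ^ j * (Module.finrank K (reducedHomology K Δ _) : ℤ))]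
  have h4 := h2 (Fintype.card V + 1)
  rw [hN, mul_zero] at h4
  rw [← h4, ← Finset.sum_add_distrib]
  refine Finset.sum_congr rfl fun j _ => ?_
  rw [h1]
  ring

variable {K}

theorem LayeredMatching.subsingleton_reducedHomology [Nonempty V] {Δ : FaceFamily V}
    {C : Set (Finset V)} (m : LayeredMatching {σ | σ ∉ Δ} C) {i : ℤ}
    (hC : ∀ σ ∉ Δ, σ ∈ C → (σ.card : ℤ) ≠ i + 2) : Subsingleton (reducedHomology K Δ i) := by
  obtain ⟨j, rfl⟩ : ∃ j, i = j + 1 := ⟨i - 1, by ring⟩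
  obtain ⟨e⟩ := nonempty_homology_equiv (reducedChainComplex K Δ) j
  refine e.toEquiv.subsingleton_congr.2 ?_
  rw [Submodule.Quotient.subsingleton_iff, Submodule.submoduleOf_eq_top]
  intro z hz
  rw [LinearMap.mem_ker, reducedChainComplex_d] at hz
  obtain ⟨v, hv, h⟩ := m.exists_boundary_eq hC z.2 (congrArg Subtype.val hz)
  refine ⟨(⟨v, hv⟩ : chains K Δ (j + 1 + 1)), ?_⟩
  rw [reducedChainComplex_d]
  exact Subtype.ext h

/-- If all critical sets of a layered matching on the sets outside of `Δ` have `c + 1` elements,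
their number is the dimension of the reduced homology in degree `c - 1`. -/
theorem LayeredMatching.finrank_reducedHomology [Nonempty V] {Δ : FaceFamily V}
    {C : Set (Finset V)} (m : LayeredMatching {σ | σ ∉ Δ} C) {c : ℕ}
    (hC : ∀ σ ∉ Δ, σ ∈ C → σ.card = c + 1) (hc : c ≤ Fintype.card V) :
    Module.finrank K (reducedHomology K Δ ((c : ℤ) - 1)) = {σ | σ ∉ Δ ∧ σ ∈ C}.ncard := by
  classical
  have h1 := sum_neg_one_pow_card_eq_sum_finrank K Δ
  rw [Finset.sum_eq_single c] at h1
  · have h2 := m.sum_neg_one_pow_card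
    -- The alternating sum over the full simplex is zero, so the sums over faces and over non-faces
    -- are opposite.
    have h3 : ∑ σ : Finset V, (-1 : ℤ) ^ σ.card = 0 := by
      have := (LayeredMatching.univ (Classical.arbitrary V)).sum_neg_one_pow_card
      simpa using this
    rw [← Finset.sum_filter_add_sum_filter_not _ (· ∈ Δ), h1] at h3
    simp only [Set.mem_ofPred_eq] at h2
    rw [h2, Finset.sum_congr rfl (fun σ hσ => by
      rw [hC σ (Finset.mem_filter.1 hσ).2.1 (Finset.mem_filter.1 hσ).2.2]), Finset.sum_const,
      nsmul_eq_mul, pow_succ] at h3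
    have h4 : (-1 : ℤ) ^ c ≠ 0 := pow_ne_zero _ (by norm_num)
    have h5 : (Module.finrank K (reducedHomology K Δ ((c : ℤ) - 1)) : ℤ) =
        (Finset.univ.filter fun σ => σ ∉ Δ ∧ σ ∈ C).card := by
      apply mul_left_cancel₀ h4
      linarith
    rw [← Set.ncard_coe_finset] at h5
    simpa using h5
  · intro j _ hj
    have := m.subsingleton_reducedHomology (K := K) (i := (j : ℤ) - 1) (fun σ h1 h2 => by
      rw [hC σ h1 h2]; push_cast; omega)
    rw [Module.finrank_zero_of_subsingleton]
    simp
  · intro h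
    exact absurd (Finset.mem_range.2 (Nat.lt_succ_of_le hc)) h

end Finrank

/-! ### Dense sets of residues and the sequence of marks -/

section Marks

/-- The increasing sequence `0, t - b, t + 1, (t + 1) + (t - b), 2 (t + 1), …`. -/
def mark (t b k : ℕ) : ℕ := k / 2 * (t + 1) + k % 2 * (t - b)

theorem mark_zero (t b : ℕ) : mark t b 0 = 0 := by simp [mark]

theorem mark_even (t b q : ℕ) : mark t b (2 * q) = q * (t + 1) := by
  simp [mark]

theorem mark_odd (t b q : ℕ) : mark t b (2 * q + 1) = q * (t + 1) + (t - b) := by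
  have h1 : (2 * q + 1) / 2 = q := by omega
  have h2 : (2 * q + 1) % 2 = 1 := by omega
  rw [mark, h1, h2, one_mul]

theorem mark_add_two (t b k : ℕ) : mark t b (k + 2) = mark t b k + (t + 1) := by
  have h1 : (k + 2) / 2 = k / 2 + 1 := by omega
  have h2 : (k + 2) % 2 = k % 2 := by omega
  rw [mark, mark, h1, h2]
  ring

variable {n t b : ℕ}

theorem mark_lt_succ (hb : b < t) (k : ℕ) : mark t b k < mark t b (k + 1) := by
  obtain ⟨q, rfl | rfl⟩ := Nat.even_or_odd' k
  · rw [mark_even, mark_odd]; omega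
  · rw [mark_odd, show 2 * q + 1 + 1 = 2 * (q + 1) by ring, mark_even, add_one_mul]; omega

theorem mark_succ_le (hb : b < t) (k : ℕ) : mark t b (k + 1) ≤ mark t b k + t := by
  obtain ⟨q, rfl | rfl⟩ := Nat.even_or_odd' k
  · rw [mark_even, mark_odd]; omega
  · rw [mark_odd, show 2 * q + 1 + 1 = 2 * (q + 1) by ring, mark_even, add_one_mul]; omega

theorem mark_strictMono (hb : b < t) : StrictMono (mark t b) :=
  strictMono_nat_of_lt_succ (mark_lt_succ hb)

/-- A set of residues modulo `n` meeting every cyclic interval of length `t`. -/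
def IsDense (n t : ℕ) (s : Finset ℕ) : Prop :=
  (∀ y ∈ s, y < n) ∧ ∀ a < n, ∃ y ∈ s, a ≤ y ∧ y < a + t ∨ y + n < a + t

/-- The largest element of a nonempty set. -/
def top (s : Finset ℕ) : ℕ := s.sup id

theorem le_top {s : Finset ℕ} {y : ℕ} (hy : y ∈ s) : y ≤ top s := Finset.le_sup (f := id) hy

theorem top_mem {s : Finset ℕ} (hs : s.Nonempty) : top s ∈ s := by
  obtain ⟨y, hy, h⟩ := Finset.exists_mem_eq_sup s hs id
  rw [top, h]
  exact hy

theorem top_eq {s : Finset ℕ} {M : ℕ} (hM : M ∈ s) (h : ∀ y ∈ s, y ≤ M) : top s = M :=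
  le_antisymm (h _ (top_mem ⟨M, hM⟩)) (le_top hM)

theorem IsDense.nonempty {s : Finset ℕ} (hs : IsDense n t s) (hn : 0 < n) : s.Nonempty := by
  obtain ⟨y, hy, -⟩ := hs.2 0 hn
  exact ⟨y, hy⟩

/-- The number of elements of `{0, …, n - 1}` beyond the largest element of `s`. -/
def tail (n : ℕ) (s : Finset ℕ) : ℕ := n - 1 - top s

/-- The set `s` contains the `j`-th mark and nothing between it and the next mark. -/
def FollowsMark (t b : ℕ) (s : Finset ℕ) (j : ℕ) : Prop :=
  mark t b j ∈ s ∧ ∀ y ∈ s, mark t b j < y → mark t b (j + 1) ≤ y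

/-- The number of initial marks followed by `s`. -/
noncomputable def depth (n t : ℕ) (s : Finset ℕ) : ℕ :=
  sInf {j | ¬ FollowsMark t (tail n s) s j}

theorem IsDense.top_lt {s : Finset ℕ} (hs : IsDense n t s) (hn : 0 < n) : top s < n :=
  hs.1 _ (top_mem (hs.nonempty hn))

theorem IsDense.tail_add {s : Finset ℕ} (hs : IsDense n t s) (hn : 0 < n) :
    top s + tail n s + 1 = n := by
  have := hs.top_lt hn
  rw [tail]
  omega

theorem IsDense.tail_lt {s : Finset ℕ} (hs : IsDense n t s) (ht : 0 < t) (htn : t ≤ n) :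
    tail n s < t := by
  obtain ⟨y, hy, h⟩ := hs.2 (n - t) (by omega)
  have := le_top hy
  have := hs.tail_add (by omega)
  omega

theorem IsDense.not_followsMark {s : Finset ℕ} (hs : IsDense n t s) (hb : b < t) :
    ¬ FollowsMark t b s n := by
  intro h
  have h1 := hs.1 _ h.1
  have h2 := (mark_strictMono hb).le_apply (x := n)
  omega

theorem depth_eq {s : Finset ℕ} {k : ℕ} (h1 : ∀ j < k, FollowsMark t (tail n s) s j)
    (h2 : ¬ FollowsMark t (tail n s) s k) : depth n t s = k := by
  refine le_antisymm (Nat.sInf_le h2) (le_csInf ⟨k, h2⟩ fun j hj => ?_)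
  by_contra hlt
  exact hj (h1 j (not_le.1 hlt))

theorem followsMark_of_lt_depth {s : Finset ℕ} {j : ℕ} (h : j < depth n t s) :
    FollowsMark t (tail n s) s j :=
  not_not.1 (Nat.notMem_of_lt_sInf h)

theorem IsDense.depth_le {s : Finset ℕ} (hs : IsDense n t s) (ht : 0 < t) (htn : t ≤ n) :
    depth n t s ≤ n :=
  Nat.sInf_le (hs.not_followsMark (hs.tail_lt ht htn))

theorem IsDense.not_followsMark_depth {s : Finset ℕ} (hs : IsDense n t s) (ht : 0 < t)
    (htn : t ≤ n) : ¬ FollowsMark t (tail n s) s (depth n t s) :=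
  Nat.sInf_mem (s := {j | ¬ FollowsMark t (tail n s) s j})
    ⟨n, hs.not_followsMark (hs.tail_lt ht htn)⟩

theorem exists_eq_mark {s : Finset ℕ} {k y : ℕ} (h : ∀ j < k, FollowsMark t b s j) (hy : y ∈ s)
    (hyk : y < mark t b k) : ∃ j < k, y = mark t b j := by
  induction k with
  | zero => simp [mark_zero] at hyk
  | succ k ih =>
    rcases lt_trichotomy y (mark t b k) with h1 | h1 | h1
    · obtain ⟨j, hj, e⟩ := ih (fun j hj => h j (hj.trans k.lt_succ_self)) h1
      exact ⟨j, hj.trans k.lt_succ_self, e⟩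
    · exact ⟨k, k.lt_succ_self, h1⟩
    · exact absurd ((h k k.lt_succ_self).2 y hy h1) (not_le.2 hyk)

/-- A missing mark forces an element before the next one: the window of length `t` starting just
after the mark two steps before the next one ends right before that next mark, and what precedes the
missing mark is already known. -/
theorem IsDense.exists_between {s : Finset ℕ} (hs : IsDense n t s) (ht : 0 < t) (htn : t ≤ n)
    {k : ℕ} (h : ∀ j < k, FollowsMark t (tail n s) s j) (hk : mark t (tail n s) k < top s)
    (hks : mark t (tail n s) k ∉ s) :
    ∃ y ∈ s, mark t (tail n s) k < y ∧ y < mark t (tail n s) (k + 1) := by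
  have hb := hs.tail_lt ht htn
  have hM := hs.tail_add (by omega)
  have hMs := top_mem (hs.nonempty (by omega))
  set b := tail n s
  cases k with
  | zero =>
    have h1 : mark t b (0 + 1) = t - b := by simpa using mark_odd t b 0
    rw [mark_zero] at hks
    rw [mark_zero, h1]
    have key : ∃ y ∈ s, y < t - b := by
      -- If `b > 0`, the window starting after the largest element wraps around and can only be met
      -- below `t - b`. If `b = 0`, that start would be `n`, so the window at `0` replaces it.
      rcases Nat.eq_zero_or_pos b with h0 | h0
      · obtain ⟨y, hy, h⟩ := hs.2 0 (by omega)
        exact ⟨y, hy, by omega⟩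
      · obtain ⟨y, hy, h⟩ := hs.2 (top s + 1) (by omega)
        have := le_top hy
        exact ⟨y, hy, by omega⟩
    obtain ⟨y, hy, h2⟩ := key
    exact ⟨y, hy, Nat.pos_of_ne_zero fun e => hks (e ▸ hy), h2⟩
  | succ j =>
    have h2 : mark t b (j + 1 + 1) = _ := mark_add_two t b j
    have h3 := mark_lt_succ hb j
    obtain ⟨y, hy, h4⟩ := hs.2 (mark t b j + 1) (by omega)
    rcases h4 with h4 | h4
    · refine ⟨y, hy, lt_of_le_of_ne ((h j j.lt_succ_self).2 y hy (by omega))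
        fun e => hks (e ▸ hy), by omega⟩
    · exact ⟨top s, hMs, hk, by omega⟩

/-- A first mark missing from `r` would, by density, put an element of `r`, hence of `s`, strictly
between two consecutive marks where `s` has none. This makes `depth` antitone among dense sets with
the same largest element. -/
theorem IsDense.followsMark_of_subset {s r : Finset ℕ} (hr : IsDense n t r) (ht : 0 < t)
    (htn : t ≤ n) (hrs : r ⊆ s) (htop : top r = top s) {k : ℕ}
    (h : ∀ j < k, FollowsMark t (tail n s) s j) : ∀ j < k, FollowsMark t (tail n r) r j := by
  have htail : tail n r = tail n s := by rw [tail, tail, htop]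
  induction k with
  | zero => intro j hj; omega
  | succ k ih =>
    have ih' := ih fun j hj => h j (hj.trans k.lt_succ_self)
    have hk := h k k.lt_succ_self
    rw [← htail] at hk
    intro j hj
    rcases Nat.lt_succ_iff_lt_or_eq.1 hj with hj | rfl
    · exact ih' j hj
    · refine ⟨?_, fun y hy => hk.2 y (hrs hy)⟩
      by_contra hn
      have hlt : mark t (tail n r) j < top r := by
        refine lt_of_le_of_ne (htop ▸ le_top hk.1) fun e => hn ?_
        rw [e]
        exact top_mem (hr.nonempty (by omega))
      obtain ⟨y, hy, h1, h2⟩ := hr.exists_between ht htn ih' hlt hn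
      exact absurd (hk.2 y (hrs hy) h1) (not_le.2 h2)

/-- Each window using the erased mark also contains the previous mark, the largest element, or `z`:
the previous mark and the one after the erased mark are `t + 1` apart, so a window starting between
the previous and the erased mark reaches `z`. -/
theorem IsDense.erase_mark {s : Finset ℕ} (hs : IsDense n t s) (ht : 0 < t) (htn : t ≤ n)
    {k : ℕ} (h : ∀ j < k, FollowsMark t (tail n s) s j) (hk : mark t (tail n s) k < top s)
    {z : ℕ} (hz : z ∈ s) (h1 : mark t (tail n s) k < z) (h2 : z < mark t (tail n s) (k + 1)) :
    IsDense n t (s.erase (mark t (tail n s) k)) := by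
  have hb := hs.tail_lt ht htn
  have hM := hs.tail_add (by omega)
  have hMs := top_mem (hs.nonempty (by omega))
  refine ⟨fun y hy => hs.1 y (Finset.mem_of_mem_erase hy), fun a ha => ?_⟩
  obtain ⟨y, hy, hya⟩ := hs.2 a ha
  set b := tail n s
  have hzn := hs.1 z hz
  by_cases hyk : y = mark t b k
  · subst hyk
    -- Once windows containing the largest element are set aside, one that wraps around must start
    -- beyond that element.
    by_cases haM : top s < a + t ∧ a ≤ top s
    · exact ⟨top s, Finset.mem_erase.2 ⟨hk.ne', hMs⟩, by omega⟩
    cases k with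
    | zero =>
      have e1 : mark t b (0 + 1) = t - b := by simpa using mark_odd t b 0
      have e0 := mark_zero t b
      exact ⟨z, Finset.mem_erase.2 ⟨h1.ne', hz⟩, by omega⟩
    | succ j =>
      have e2 : mark t b (j + 1 + 1) = _ := mark_add_two t b j
      have e3 := mark_lt_succ hb j
      have hj := (h j j.lt_succ_self).1
      by_cases haj : a ≤ mark t b j ∨ mark t b (j + 1) < a
      · exact ⟨mark t b j, Finset.mem_erase.2 ⟨e3.ne, hj⟩, by omega⟩
      · exact ⟨z, Finset.mem_erase.2 ⟨h1.ne', hz⟩, by omega⟩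
  · exact ⟨y, Finset.mem_erase.2 ⟨hyk, hy⟩, hya⟩

/-- The mark that is added to or removed from a dense set. -/
noncomputable def pivotMark (n t : ℕ) (s : Finset ℕ) : ℕ := mark t (tail n s) (depth n t s)

theorem toggle_subset_insert (x : ℕ) (s : Finset ℕ) : toggle x s ⊆ insert x s := by
  by_cases h : x ∈ s
  · rw [toggle_of_mem h]
    exact (Finset.erase_subset x s).trans (Finset.subset_insert x s)
  · rw [toggle_of_notMem h]

theorem mem_toggle_of_ne {x y : ℕ} {s : Finset ℕ} (h : y ≠ x) : y ∈ toggle x s ↔ y ∈ s := by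
  by_cases hx : x ∈ s
  · rw [toggle_of_mem hx, Finset.mem_erase]; tauto
  · rw [toggle_of_notMem hx, Finset.mem_insert]; tauto

theorem IsDense.toggle_pivotMark {s : Finset ℕ} (hs : IsDense n t s) (ht : 0 < t) (htn : t ≤ n)
    (hc : pivotMark n t s < top s) :
    IsDense n t (toggle (pivotMark n t s) s) ∧ top (toggle (pivotMark n t s) s) = top s ∧
      depth n t (toggle (pivotMark n t s) s) = depth n t s := by
  have hb := hs.tail_lt ht htn
  have hMs := top_mem (hs.nonempty (by omega))
  have hlt : ∀ j < depth n t s, FollowsMark t (tail n s) s j :=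
    fun j hj => followsMark_of_lt_depth hj
  have hnot := hs.not_followsMark_depth ht htn
  have htop : top (toggle (pivotMark n t s) s) = top s := by
    refine top_eq ((mem_toggle_of_ne hc.ne').2 hMs) fun y hy => ?_
    rcases Finset.mem_insert.1 (toggle_subset_insert _ _ hy) with rfl | h
    · exact hc.le
    · exact le_top h
  have htail : tail n (toggle (pivotMark n t s) s) = tail n s := by rw [tail, tail, htop]
  have hfol : ∀ j < depth n t s,
      FollowsMark t (tail n (toggle (pivotMark n t s) s)) (toggle (pivotMark n t s) s) j := by
    intro j hj
    rw [htail]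
    refine ⟨(mem_toggle_of_ne ((mark_strictMono hb) hj).ne).2 (hlt j hj).1, fun y hy hjy => ?_⟩
    rcases Finset.mem_insert.1 (toggle_subset_insert _ _ hy) with rfl | h
    · exact (mark_strictMono hb).monotone hj
    · exact (hlt j hj).2 y h hjy
  by_cases hx : pivotMark n t s ∈ s
  · have hz : ∃ z ∈ s, pivotMark n t s < z ∧ z < mark t (tail n s) (depth n t s + 1) := by
      by_contra! hz
      exact hnot ⟨hx, hz⟩
    obtain ⟨z, hz, h1, h2⟩ := hz
    refine ⟨?_, htop, depth_eq hfol ?_⟩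
    · rw [toggle_of_mem hx]
      exact hs.erase_mark ht htn hlt hc hz h1 h2
    · rw [htail, toggle_of_mem hx]
      exact fun h => Finset.notMem_erase _ _ h.1
  · obtain ⟨z, hz, h1, h2⟩ := hs.exists_between ht htn hlt hc hx
    refine ⟨?_, htop, depth_eq hfol ?_⟩
    · rw [toggle_of_notMem hx]
      refine ⟨fun y hy => ?_, fun a ha => ?_⟩
      · rcases Finset.mem_insert.1 hy with rfl | h
        · exact hc.trans (hs.top_lt (by omega))
        · exact hs.1 y h
      · obtain ⟨y, hy, h⟩ := hs.2 a ha
        exact ⟨y, Finset.mem_insert_of_mem hy, h⟩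
    · rw [htail]
      exact fun h => absurd (h.2 z ((mem_toggle_of_ne h1.ne').2 hz) h1) (not_le.2 h2)

/-- All elements lie at or below the first mark that is not followed. None equals it, for then it
would be the largest element and be followed vacuously. So every element is an earlier mark. -/
theorem IsDense.eq_image_mark {s : Finset ℕ} (hs : IsDense n t s) (ht : 0 < t) (htn : t ≤ n)
    (hc : top s ≤ pivotMark n t s) : ∃ m, s = (Finset.range (m + 1)).image (mark t (tail n s)) ∧
      mark t (tail n s) m + tail n s + 1 = n := by
  have hb := hs.tail_lt ht htn
  have hMs := top_mem (hs.nonempty (by omega))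
  have hlt : ∀ j < depth n t s, FollowsMark t (tail n s) s j :=
    fun j hj => followsMark_of_lt_depth hj
  have hnot := hs.not_followsMark_depth ht htn
  have hmem : ∀ y ∈ s, ∃ j < depth n t s, y = mark t (tail n s) j := by
    intro y hy
    refine exists_eq_mark hlt hy (lt_of_le_of_ne ((le_top hy).trans hc) fun e => hnot ?_)
    refine ⟨e ▸ hy, fun z hz h => ?_⟩
    have h1 := (le_top hz).trans hc
    rw [pivotMark] at h1
    omega
  obtain ⟨j, hj, hjM⟩ := hmem _ hMs
  obtain ⟨m, hm⟩ : ∃ m, depth n t s = m + 1 := ⟨depth n t s - 1, by omega⟩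
  rw [hm] at hmem hlt hj
  have hjm : mark t (tail n s) m = top s := by
    refine le_antisymm (le_top (hlt m m.lt_succ_self).1) ?_
    rw [hjM]
    exact (mark_strictMono hb).monotone (Nat.le_of_lt_succ hj)
  refine ⟨m, ?_, by rw [hjm]; exact hs.tail_add (by omega)⟩
  ext y
  simp only [Finset.mem_image, Finset.mem_range]
  constructor
  · intro hy
    obtain ⟨i, hi, e⟩ := hmem y hy
    exact ⟨i, hi, e.symm⟩
  · rintro ⟨i, hi, rfl⟩
    exact (hlt i hi).1

theorem top_image_mark (hb : b < t) (m : ℕ) :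
    top ((Finset.range (m + 1)).image (mark t b)) = mark t b m := by
  refine top_eq (Finset.mem_image_of_mem _ (Finset.self_mem_range_succ m)) fun y hy => ?_
  obtain ⟨i, hi, rfl⟩ := Finset.mem_image.1 hy
  exact (mark_strictMono hb).monotone (Nat.le_of_lt_succ (Finset.mem_range.1 hi))

/-- Consecutive marks differ by at most `t`, and the cyclic gap from the last mark back to `0` is `b
+ 1 ≤ t`. -/
theorem isDense_image_mark (hb : b < t) {m : ℕ} (hm : mark t b m + b + 1 = n) :
    IsDense n t ((Finset.range (m + 1)).image (mark t b)) := by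
  have hmem : ∀ j ≤ m, mark t b j ∈ (Finset.range (m + 1)).image (mark t b) := fun j hj =>
    Finset.mem_image_of_mem _ (Finset.mem_range.2 (Nat.lt_succ_of_le hj))
  refine ⟨fun y hy => ?_, fun a ha => ?_⟩
  · have := le_top hy
    rw [top_image_mark hb] at this
    omega
  · by_cases h : mark t b m < a
    · refine ⟨mark t b 0, hmem 0 (Nat.zero_le m), ?_⟩
      rw [mark_zero]
      omega
    · have hex : ∃ j, a ≤ mark t b j := ⟨m, not_lt.1 h⟩
      classical
      have h1 := Nat.find_spec hex
      have h2 := Nat.find_min' hex (not_lt.1 h)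
      refine ⟨_, hmem _ h2, Or.inl ⟨h1, ?_⟩⟩
      rcases hj : Nat.find hex with _ | j
      · rw [mark_zero]; omega
      · have h3 := Nat.find_min hex (m := j) (by omega)
        have := mark_succ_le hb j
        omega

theorem top_le_pivotMark_image_mark (hb : b < t) {m : ℕ} (hm : mark t b m + b + 1 = n) :
    top ((Finset.range (m + 1)).image (mark t b)) ≤
      pivotMark n t ((Finset.range (m + 1)).image (mark t b)) := by
  have htop := top_image_mark hb m
  have htail : tail n ((Finset.range (m + 1)).image (mark t b)) = b := by
    rw [tail, htop]
    omega
  have hd : depth n t ((Finset.range (m + 1)).image (mark t b)) = m + 1 := by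
    refine depth_eq (fun j hj => ?_) ?_
    · rw [htail]
      refine ⟨Finset.mem_image_of_mem _ (Finset.mem_range.2 hj), fun y hy h => ?_⟩
      obtain ⟨i, -, rfl⟩ := Finset.mem_image.1 hy
      exact (mark_strictMono hb).monotone ((mark_strictMono hb).lt_iff_lt.1 h)
    · rw [htail]
      intro h
      have := le_top h.1
      rw [htop] at this
      exact absurd (mark_lt_succ hb m) (not_lt.2 this)
  rw [pivotMark, htail, hd, htop]
  exact (mark_lt_succ hb m).le

end Marks

/-! ### The matching on dense subsets of `Fin n` and its critical sets -/

section DenseMatching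

variable {n t : ℕ}

/-- The values of the elements of a subset of `Fin n`. -/
abbrev values (σ : Finset (Fin n)) : Finset ℕ := σ.map Fin.valEmbedding

theorem values_toggle (x : Fin n) (σ : Finset (Fin n)) :
    values (toggle x σ) = toggle (x : ℕ) (values σ) := by
  by_cases h : x ∈ σ
  · have h' : (x : ℕ) ∈ values σ := Finset.mem_map_of_mem Fin.valEmbedding h
    rw [toggle_of_mem h, toggle_of_mem h', values, Finset.map_erase]
    rfl
  · have h' : (x : ℕ) ∉ values σ := fun hx => h ((Finset.mem_map' Fin.valEmbedding).1 hx)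
    rw [toggle_of_notMem h, toggle_of_notMem h', values, Finset.map_insert]
    rfl

theorem IsDense.mono {s r : Finset ℕ} (hr : IsDense n t r) (h : r ⊆ s) (hs : ∀ y ∈ s, y < n) :
    IsDense n t s :=
  ⟨hs, fun a ha => (hr.2 a ha).imp fun _ hy => ⟨h hy.1, hy.2⟩⟩

theorem lt_of_mem_values {σ : Finset (Fin n)} {y : ℕ} (hy : y ∈ values σ) : y < n := by
  obtain ⟨x, -, rfl⟩ := Finset.mem_map.1 hy
  exact x.2

/-- The layered matching on the subsets of `Fin n` meeting every cyclic interval of length `t`. -/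
noncomputable def denseMatching (n t : ℕ) [NeZero n] (ht : 0 < t) (htn : t ≤ n) :
    LayeredMatching {σ : Finset (Fin n) | IsDense n t (values σ)}
      {σ | top (values σ) ≤ pivotMark n t (values σ)} where
  -- Lexicographic order, by largest element and then by decreasing depth. Since depth is at most
  -- `n`, base `n + 1` lets both be recovered from the level, and with them the pivot.
  level σ := top (values σ) * (n + 1) + (n - depth n t (values σ))
  pivot σ := Fin.ofNat n (pivotMark n t (values σ))
  isUpperSet σ τ h hσ := hσ.mono (Finset.map_subset_map.2 h) fun y hy => lt_of_mem_values hy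
  level_mono {σ τ} hτ h := by
    have hsub : values τ ⊆ values σ := Finset.map_subset_map.2 h
    have htop : top (values τ) ≤ top (values σ) := Finset.sup_mono hsub
    rcases htop.lt_or_eq with hlt | heq
    · calc top (values τ) * (n + 1) + (n - depth n t (values τ))
          ≤ (top (values τ) + 1) * (n + 1) := by rw [add_one_mul]; omega
        _ ≤ top (values σ) * (n + 1) := Nat.mul_le_mul_right _ hlt
        _ ≤ _ := Nat.le_add_right _ _
    · have hσ : IsDense n t (values σ) := hτ.mono hsub fun y hy => lt_of_mem_values hy
      have h1 := hτ.followsMark_of_subset ht htn hsub heq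
        (k := depth n t (values σ)) fun j hj => followsMark_of_lt_depth hj
      have h2 : depth n t (values σ) ≤ depth n t (values τ) := by
        by_contra hlt
        exact hτ.not_followsMark_depth ht htn (h1 _ (not_le.1 hlt))
      rw [heq]
      omega
  pivot_congr {σ τ} hσ hτ h := by
    have h1 := hσ.depth_le ht htn
    have h2 := hτ.depth_le ht htn
    have h3 : top (values σ) = top (values τ) := by
      have e : ∀ M d : ℕ, (M * (n + 1) + (n - d)) / (n + 1) = M := by
        intro M d
        rw [mul_comm, Nat.mul_add_div (Nat.succ_pos n), Nat.div_eq_of_lt (by omega), add_zero]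
      rw [← e (top (values σ)) (depth n t (values σ)), h, e]
    have h4 : depth n t (values σ) = depth n t (values τ) := by
      rw [h3] at h
      omega
    rw [pivotMark, pivotMark, tail, tail, h3, h4]
  toggle_mem {σ} hσ hc := by
    have hc' : pivotMark n t (values σ) < top (values σ) := not_le.1 fun h => hc h
    have hlt := hc'.trans (hσ.top_lt (ht.trans_le htn))
    rw [Set.mem_ofPred_eq, values_toggle, Fin.val_ofNat, Nat.mod_eq_of_lt hlt]
    exact (IsDense.toggle_pivotMark hσ ht htn hc').1
  level_toggle {σ} hσ hc := by
    have hc' : pivotMark n t (values σ) < top (values σ) := not_le.1 fun h => hc h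
    have hlt := hc'.trans (hσ.top_lt (ht.trans_le htn))
    rw [values_toggle, Fin.val_ofNat, Nat.mod_eq_of_lt hlt,
      (IsDense.toggle_pivotMark hσ ht htn hc').2.1, (IsDense.toggle_pivotMark hσ ht htn hc').2.2]
  toggle_notMem_critical {σ} hσ hc := by
    have hc' : pivotMark n t (values σ) < top (values σ) := not_le.1 fun h => hc h
    have hlt := hc'.trans (hσ.top_lt (ht.trans_le htn))
    rw [Set.mem_ofPred_eq, values_toggle, Fin.val_ofNat, Nat.mod_eq_of_lt hlt, not_le]
    obtain ⟨-, h1, h2⟩ := IsDense.toggle_pivotMark hσ ht htn hc'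
    rw [pivotMark, tail, h1, h2]
    exact hc'

/-- The subset of `Fin n` consisting of the first `k` marks. -/
def markSet (n t b k : ℕ) : Finset (Fin n) :=
  Finset.univ.filter fun y => (y : ℕ) ∈ (Finset.range k).image (mark t b)

theorem values_markSet {b m : ℕ} (hb : b < t) (hm : mark t b m + b + 1 = n) :
    values (markSet n t b (m + 1)) = (Finset.range (m + 1)).image (mark t b) := by
  ext y
  simp only [values, markSet, Finset.mem_map, Finset.mem_filter, Finset.mem_univ, true_and]
  constructor
  · rintro ⟨x, hx, rfl⟩
    exact hx
  · intro hy
    exact ⟨⟨y, (isDense_image_mark hb hm).1 y hy⟩, hy, rfl⟩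

theorem card_markSet {b m : ℕ} (hb : b < t) (hm : mark t b m + b + 1 = n) :
    (markSet n t b (m + 1)).card = m + 1 := by
  rw [← Finset.card_map Fin.valEmbedding]
  change (values _).card = _
  rw [values_markSet hb hm, Finset.card_image_of_injective _ (mark_strictMono hb).injective,
    Finset.card_range]

theorem dense_critical_iff (ht : 0 < t) (htn : t ≤ n) (σ : Finset (Fin n)) :
    IsDense n t (values σ) ∧ top (values σ) ≤ pivotMark n t (values σ) ↔
      ∃ b < t, ∃ m, mark t b m + b + 1 = n ∧ σ = markSet n t b (m + 1) := by
  constructor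
  · rintro ⟨hσ, hc⟩
    obtain ⟨m, h1, h2⟩ := hσ.eq_image_mark ht htn hc
    have hb := hσ.tail_lt ht htn
    refine ⟨_, hb, m, h2, Finset.map_injective Fin.valEmbedding ?_⟩
    exact h1.trans (values_markSet hb h2).symm
  · rintro ⟨b, hb, m, hm, rfl⟩
    rw [values_markSet hb hm]
    exact ⟨isDense_image_mark hb hm, top_le_pivotMark_image_mark hb hm⟩

/-- For even `m` the left side is `b + 1` modulo `t + 1`, which is never `0` and fixes `b`. For odd
`m` the value `b` cancels and the left side is a multiple of `t + 1`; this is where the `t` critical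
sets for `d = 0` come from. -/
theorem mark_add_eq_iff {b m p d : ℕ} (hb : b < t) (hd : d ≤ t) :
    mark t b m + b + 1 = (t + 1) * p + d ↔ d ≠ 0 ∧ b + 1 = d ∧ m = 2 * p ∨
      d = 0 ∧ m + 1 = 2 * p := by
  have huniq : ∀ q r : ℕ, r ≤ t → (q * (t + 1) + r = (t + 1) * p + d ↔ q = p ∧ r = d) := by
    intro q r hr
    refine ⟨fun h => ?_, fun h => by rw [h.1, h.2, mul_comm]⟩
    have h1 : (q * (t + 1) + r) / (t + 1) = ((t + 1) * p + d) / (t + 1) := by rw [h]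
    rw [mul_comm, Nat.mul_add_div (Nat.succ_pos t), Nat.mul_add_div (Nat.succ_pos t),
      Nat.div_eq_of_lt (by omega), Nat.div_eq_of_lt (by omega), add_zero, add_zero] at h1
    subst h1
    rw [mul_comm] at h
    exact ⟨rfl, by omega⟩
  obtain ⟨q, rfl | rfl⟩ := Nat.even_or_odd' m
  · rw [mark_even, add_assoc, huniq _ _ (by omega)]
    omega
  · have e : q * (t + 1) + (t - b) + b + 1 = (q + 1) * (t + 1) + 0 := by
      rw [add_one_mul]
      omega
    rw [mark_odd, e, huniq _ _ (Nat.zero_le t)]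
    omega

theorem card_of_dense_critical {p d : ℕ} (ht : 0 < t) (htn : t ≤ n) (hn : n = (t + 1) * p + d)
    (hd : d ≤ t) {σ : Finset (Fin n)} (hσ : IsDense n t (values σ))
    (hc : top (values σ) ≤ pivotMark n t (values σ)) :
    σ.card = if d = 0 then 2 * p else 2 * p + 1 := by
  obtain ⟨b, hb, m, hm, rfl⟩ := (dense_critical_iff ht htn σ).1 ⟨hσ, hc⟩
  rw [card_markSet hb hm]
  rw [hn, mark_add_eq_iff hb hd] at hm
  split_ifs <;> omega

theorem ncard_dense_critical {p d : ℕ} (ht : 0 < t) (htn : t ≤ n) (hn : n = (t + 1) * p + d)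
    (hd : d ≤ t) :
    {σ : Finset (Fin n) | IsDense n t (values σ) ∧
      top (values σ) ≤ pivotMark n t (values σ)}.ncard = if d = 0 then t else 1 := by
  simp only [dense_critical_iff ht htn]
  split_ifs with h0
  · have hp : 0 < p := by
      rcases Nat.eq_zero_or_pos p with rfl | h
      · omega
      · exact h
    have key : ∀ b < t, mark t b (2 * p - 1) + b + 1 = n := fun b hb => by
      rw [hn, mark_add_eq_iff hb hd]; omega
    have e : {σ : Finset (Fin n) | ∃ b < t, ∃ m, mark t b m + b + 1 = n ∧
        σ = markSet n t b (m + 1)} =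
        (fun b => markSet n t b (2 * p - 1 + 1)) '' (Finset.range t : Set ℕ) := by
      ext σ
      simp only [Set.mem_ofPred_eq, Set.mem_image, Finset.mem_coe, Finset.mem_range]
      constructor
      · rintro ⟨b, hb, m, hm, rfl⟩
        rw [hn, mark_add_eq_iff hb hd] at hm
        obtain rfl : m = 2 * p - 1 := by omega
        exact ⟨b, hb, rfl⟩
      · rintro ⟨b, hb, rfl⟩
        exact ⟨b, hb, _, key b hb, rfl⟩
    rw [e, Set.InjOn.ncard_image ?_, Set.ncard_coe_finset, Finset.card_range]
    intro b hb b' hb' h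
    simp only [Finset.mem_coe, Finset.mem_range] at hb hb'
    have h1 := congrArg (fun σ => top (values σ)) h
    simp only [values_markSet hb (key b hb), values_markSet hb' (key b' hb'),
      top_image_mark hb, top_image_mark hb'] at h1
    have := key b hb
    have := key b' hb'
    omega
  · rw [Set.ncard_eq_one]
    refine ⟨markSet n t (d - 1) (2 * p + 1), ?_⟩
    ext σ
    simp only [Set.mem_ofPred_eq, Set.mem_singleton_iff]
    constructor
    · rintro ⟨b, hb, m, hm, rfl⟩
      rw [hn, mark_add_eq_iff hb hd] at hm
      obtain ⟨rfl, rfl⟩ : b = d - 1 ∧ m = 2 * p := by omega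
      rfl
    · rintro rfl
      refine ⟨d - 1, by omega, 2 * p, ?_, rfl⟩
      rw [hn, mark_add_eq_iff (by omega) hd]
      omega

end DenseMatching

/-! ### From path ideals to vertex sets of paths -/

section PathComplex

variable {V : Type v}

/-- The vertex sets of the paths of `G` with `t` vertices. -/
def pathSupports [DecidableEq V] (G : SimpleGraph V) (t : ℕ) : Set (Finset V) :=
  {F | ∃ (x y : V) (w : G.Walk x y), w.IsPath ∧ w.length + 1 = t ∧ w.support.toFinset = F}

variable [DecidableEq V] {G : SimpleGraph V} {t : ℕ}

theorem card_of_mem_pathSupports {F : Finset V} (hF : F ∈ pathSupports G t) : F.card = t := by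
  obtain ⟨x, y, w, hw, hl, rfl⟩ := hF
  rw [List.toFinset_card_of_nodup hw.support_nodup, SimpleGraph.Walk.length_support, hl]

theorem sum_single_one_apply (σ : Finset V) (y : V) :
    (∑ x ∈ σ, Finsupp.single x (1 : ℕ)) y = if y ∈ σ then 1 else 0 := by
  simp [Finsupp.single_apply]

/-- Membership in a monomial ideal is divisibility by a generator, which for square-free monomials
is containment of supports. -/
theorem prod_X_mem_pathIdeal_iff (K : Type u) [Field K] {σ : Finset V} :
    ∏ x ∈ σ, MvPolynomial.X x ∈ pathIdeal K G t ↔ ∃ F ∈ pathSupports G t, F ⊆ σ := by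
  have hprod : ∀ τ : Finset V, ∏ x ∈ τ, (MvPolynomial.X x : MvPolynomial V K) =
      MvPolynomial.monomial (∑ x ∈ τ, Finsupp.single x 1) 1 := fun τ =>
    (MvPolynomial.monomial_sum_one τ fun x => Finsupp.single x 1).symm
  have hI : pathIdeal K G t = Ideal.span ((fun s => MvPolynomial.monomial s (1 : K)) ''
      ((fun F : Finset V => ∑ x ∈ F, Finsupp.single x 1) '' pathSupports G t)) := by
    rw [pathIdeal]
    congr 1
    ext m
    simp only [Set.mem_ofPred_eq, Set.mem_image, exists_exists_and_eq_and]
    constructor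
    · rintro ⟨x, y, w, hw, hl, rfl⟩
      refine ⟨_, ⟨x, y, w, hw, hl, rfl⟩, ?_⟩
      rw [← hprod, List.prod_toFinset _ hw.support_nodup]
    · rintro ⟨_, ⟨x, y, w, hw, hl, rfl⟩, rfl⟩
      refine ⟨x, y, w, hw, hl, ?_⟩
      rw [← hprod, List.prod_toFinset _ hw.support_nodup]
  classical
  rw [hI, hprod, MvPolynomial.mem_ideal_span_monomial_image, MvPolynomial.support_monomial,
    if_neg one_ne_zero]
  simp only [Finset.mem_singleton, forall_eq, Set.mem_image, exists_exists_and_eq_and]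
  refine exists_congr fun F => and_congr_right fun _ => ?_
  rw [Finsupp.le_def]
  simp only [sum_single_one_apply]
  constructor
  · intro h y hy
    have := h y
    by_contra hn
    simp [hy, hn] at this
  · intro h y
    by_cases hy : y ∈ F
    · simp [hy, h hy]
    · simp [hy]

/-- All path supports have `t` elements, so none properly contains another. -/
theorem minimal_prod_X_mem_pathIdeal_iff (K : Type u) [Field K] {F : Finset V} :
    Minimal (fun σ : Finset V => ∏ x ∈ σ, MvPolynomial.X x ∈ pathIdeal K G t) F ↔
      F ∈ pathSupports G t := by
  simp only [prod_X_mem_pathIdeal_iff]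
  constructor
  · rintro ⟨⟨F', h1, h2⟩, hmin⟩
    have := hmin ⟨F', h1, subset_rfl⟩ h2
    rwa [subset_antisymm this h2]
  · intro hF
    refine ⟨⟨F, hF, subset_rfl⟩, ?_⟩
    rintro σ ⟨F', h1, h2⟩ h3
    have h4 : F' = F := Finset.eq_of_subset_of_card_le (h2.trans h3)
      (by rw [card_of_mem_pathSupports hF, card_of_mem_pathSupports h1])
    exact h4 ▸ h2

theorem facets_pathComplex (K : Type u) [Field K] :
    facets (pathComplex K G t) = pathSupports G t := by
  have h0 : pathComplex K G t = generatedBy (pathSupports G t) := by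
    rw [pathComplex, facetComplex]
    simp only [minimal_prod_X_mem_pathIdeal_iff]
    rfl
  have hmem : ∀ σ, σ ∈ pathComplex K G t ↔ ∃ F ∈ pathSupports G t, σ ⊆ F := by
    intro σ
    rw [h0, generatedBy, mem_lowerClosure]
  ext F
  simp only [facets, Set.mem_ofPred_eq]
  constructor
  · rintro ⟨h1, h2⟩
    obtain ⟨F', h3, h4⟩ := (hmem F).1 h1
    rwa [subset_antisymm h4 (h2 ((hmem F').2 ⟨F', h3, subset_rfl⟩) h4)]
  · intro hF
    refine ⟨(hmem F).2 ⟨F, hF, subset_rfl⟩, fun σ h1 h2 => ?_⟩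
    obtain ⟨F', h3, h4⟩ := (hmem σ).1 h1
    have h5 : F = F' := Finset.eq_of_subset_of_card_le (h2.trans h4)
      (by rw [card_of_mem_pathSupports hF, card_of_mem_pathSupports h3])
    exact h5 ▸ h4

theorem mem_complementComplex_pathComplex_iff [Fintype V] (K : Type u) [Field K]
    {σ : Finset V} : σ ∈ complementComplex (pathComplex K G t) ↔
      ∃ F ∈ pathSupports G t, Disjoint σ F := by
  rw [complementComplex, facets_pathComplex, generatedBy, mem_lowerClosure]
  simp only [Set.mem_image, exists_exists_and_eq_and]
  exact exists_congr fun F => and_congr_right fun _ => Finset.subset_compl_iff_disjoint_right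

end PathComplex

/-! ### Paths in the cycle graph as cyclic intervals -/

section CycleGraph

variable {m : ℕ}

theorem val_add_nsmul_one (a : Fin (m + 2)) (j : ℕ) :
    ((a + j • (1 : Fin (m + 2)) : Fin (m + 2)) : ℕ) = (a + j) % (m + 2) := by
  induction j with
  | zero => simp [Nat.mod_eq_of_lt a.2]
  | succ j ih =>
    rw [succ_nsmul, ← add_assoc, Fin.val_add, ih, Fin.val_one, Nat.mod_add_mod, add_assoc]

theorem exists_isPath_cycleGraph (a : Fin (m + 2)) (k : ℕ) (hk : k < m + 2) :
    ∃ w : (SimpleGraph.cycleGraph (m + 2)).Walk a (a + k • (1 : Fin (m + 2))),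
      w.IsPath ∧ w.length = k ∧ ∀ v ∈ w.support, ∃ j ≤ k, v = a + j • (1 : Fin (m + 2)) := by
  induction k with
  | zero =>
    have e : a + 0 • (1 : Fin (m + 2)) = a := by simp
    rw [e]
    exact ⟨.nil, .nil, rfl, fun v hv => ⟨0, le_rfl, by simpa using hv⟩⟩
  | succ k ih =>
    obtain ⟨w, hw, hl, hs⟩ := ih (by omega)
    have hadj : (SimpleGraph.cycleGraph (m + 2)).Adj (a + k • (1 : Fin (m + 2)))
        (a + (k + 1) • (1 : Fin (m + 2))) := by
      rw [SimpleGraph.cycleGraph_adj, succ_nsmul, ← add_assoc]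
      exact Or.inr (add_sub_cancel_left _ _)
    refine ⟨w.concat hadj, hw.concat (fun h => ?_) hadj, by simp [hl], fun v hv => ?_⟩
    · obtain ⟨j, hj, e⟩ := hs _ h
      have h1 := congrArg Fin.val (add_left_cancel e)
      have h2 := val_add_nsmul_one (0 : Fin (m + 2)) (k + 1)
      have h3 := val_add_nsmul_one (0 : Fin (m + 2)) j
      rw [zero_add, Fin.val_zero, zero_add, Nat.mod_eq_of_lt (by omega)] at h2 h3
      omega
    · rw [SimpleGraph.Walk.support_concat, List.mem_append, List.mem_singleton] at hv
      rcases hv with hv | rfl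
      · obtain ⟨j, hj, e⟩ := hs v hv
        exact ⟨j, by omega, e⟩
      · exact ⟨k + 1, le_rfl, rfl⟩

/-- Each step of a walk is `+1` or `-1`; a path cannot backtrack, so the first step fixes the
direction of all others. -/
theorem getVert_cycleGraph_eq {x y : Fin (m + 2)}
    {w : (SimpleGraph.cycleGraph (m + 2)).Walk x y} (hw : w.IsPath) :
    ∃ ε : Fin (m + 2), (ε = 1 ∨ ε = -1) ∧ ∀ i ≤ w.length, w.getVert i = x + i • ε := by
  rcases Nat.eq_zero_or_pos w.length with h0 | h0
  · refine ⟨1, Or.inl rfl, fun i hi => ?_⟩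
    obtain rfl : i = 0 := by omega
    simp
  · have hadj : ∀ i < w.length, w.getVert (i + 1) = w.getVert i + 1 ∨
        w.getVert (i + 1) = w.getVert i - 1 := by
      intro i hi
      have := w.adj_getVert_succ hi
      rw [SimpleGraph.cycleGraph_adj] at this
      rcases this with h | h
      · right
        rw [← h, sub_sub_cancel]
      · left
        rw [← h, add_sub_cancel]
    have hstep : ∀ ε : Fin (m + 2), (ε = 1 ∨ ε = -1) → w.getVert 1 = x + ε →
        ∀ i, i + 1 ≤ w.length → w.getVert i = x + i • ε ∧
          w.getVert (i + 1) = x + (i + 1) • ε := by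
      intro ε hε h1 i
      induction i with
      | zero => intro _; simp [h1]
      | succ i ih =>
        intro hi
        obtain ⟨ih1, ih2⟩ := ih (by omega)
        refine ⟨ih2, ?_⟩
        have hne : w.getVert (i + 2) ≠ w.getVert i := by
          intro h
          have := hw.getVert_injOn (by rw [Set.mem_ofPred_eq]; omega)
            (by rw [Set.mem_ofPred_eq]; omega) h
          omega
        have h3 : w.getVert (i + 2) = w.getVert (i + 1) + ε := by
          have h4 := hadj (i + 1) (by omega)
          have h5 : w.getVert (i + 1) - ε = w.getVert i := by
            rw [ih1, ih2, succ_nsmul, ← add_assoc, add_sub_cancel_right]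
          rcases hε with rfl | rfl
          · exact h4.resolve_right fun h => hne (h.trans h5)
          · rw [← sub_eq_add_neg]
            refine h4.resolve_left fun h => hne (h.trans ?_)
            rw [← h5, sub_neg_eq_add]
        rw [h3, ih2, succ_nsmul ε (i + 1), add_assoc]
    have hx : w.getVert 0 = x := w.getVert_zero
    have key : ∀ ε : Fin (m + 2), (ε = 1 ∨ ε = -1) → w.getVert 1 = x + ε →
        ∃ ε : Fin (m + 2), (ε = 1 ∨ ε = -1) ∧ ∀ i ≤ w.length, w.getVert i = x + i • ε := by
      intro ε hε h1
      refine ⟨ε, hε, fun i hi => ?_⟩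
      cases i with
      | zero => simp
      | succ i => exact (hstep ε hε h1 i hi).2
    rcases hadj 0 h0 with h | h
    · exact key 1 (Or.inl rfl) (by rw [hx] at h; exact h)
    · exact key (-1) (Or.inr rfl) (by rw [hx] at h; rw [← sub_eq_add_neg]; exact h)

/-- A vertex set is disjoint from the support of a path with `t` vertices in the cycle graph if
and only if it misses `t` consecutive vertices. -/
theorem exists_pathSupports_cycleGraph_disjoint_iff {t : ℕ} (ht : 0 < t) (htn : t ≤ m + 2)
    {σ : Finset (Fin (m + 2))} :
    (∃ F ∈ pathSupports (SimpleGraph.cycleGraph (m + 2)) t, Disjoint σ F) ↔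
      ∃ a : Fin (m + 2), ∀ j < t, a + j • (1 : Fin (m + 2)) ∉ σ := by
  constructor
  · rintro ⟨_, ⟨x, y, w, hw, hl, rfl⟩, hd⟩
    have hmem : ∀ i, w.getVert i ∉ σ := fun i h =>
      Finset.disjoint_left.1 hd h (List.mem_toFinset.2 (w.getVert_mem_support i))
    obtain ⟨ε, rfl | rfl, h⟩ := getVert_cycleGraph_eq hw
    · exact ⟨x, fun j hj => by rw [← h j (by omega)]; exact hmem j⟩
    -- A path in the negative direction is read from its other end.
    · refine ⟨x + w.length • (-1), fun j hj => ?_⟩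
      have e : x + w.length • (-1 : Fin (m + 2)) + j • (1 : Fin (m + 2)) =
          x + (w.length - j) • (-1 : Fin (m + 2)) := by
        obtain ⟨i, hi⟩ : ∃ i, w.length = i + j := ⟨w.length - j, by omega⟩
        rw [hi, Nat.add_sub_cancel, add_nsmul, neg_nsmul _ j, ← add_assoc, neg_add_cancel_right]
      rw [e, ← h _ (Nat.sub_le _ _)]
      exact hmem _
  · rintro ⟨a, ha⟩
    obtain ⟨w, hw, hl, hs⟩ := exists_isPath_cycleGraph a (t - 1) (by omega)
    refine ⟨_, ⟨_, _, w, hw, by omega, rfl⟩, Finset.disjoint_left.2 fun v hv h => ?_⟩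
    obtain ⟨j, hj, rfl⟩ := hs v (List.mem_toFinset.1 h)
    exact ha j (by omega) hv

theorem notMem_complementComplex_cycleGraph_iff (K : Type u) [Field K] {n t : ℕ} (ht : 2 ≤ t)
    (htn : t ≤ n) {σ : Finset (Fin n)} :
    σ ∉ complementComplex (pathComplex K (SimpleGraph.cycleGraph n) t) ↔
      IsDense n t (values σ) := by
  obtain ⟨m, rfl⟩ : ∃ m, n = m + 2 := ⟨n - 2, by omega⟩
  rw [mem_complementComplex_pathComplex_iff,
    exists_pathSupports_cycleGraph_disjoint_iff (by omega) htn]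
  push Not
  constructor
  · refine fun h => ⟨fun y hy => lt_of_mem_values hy, fun a ha => ?_⟩
    obtain ⟨j, hj, hσ⟩ := h ⟨a, ha⟩
    refine ⟨_, Finset.mem_map_of_mem Fin.valEmbedding hσ, ?_⟩
    have e := val_add_nsmul_one ⟨a, ha⟩ j
    change _ ≤ Fin.val _ ∧ Fin.val _ < _ ∨ Fin.val _ + _ < _
    rw [e]
    dsimp only
    rcases lt_or_ge (a + j) (m + 2) with h1 | h1
    · rw [Nat.mod_eq_of_lt h1]; omega
    · rw [Nat.mod_eq_sub_mod h1, Nat.mod_eq_of_lt (by omega)]; omega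
  · intro h a
    obtain ⟨y, hy, hya⟩ := h.2 a a.2
    obtain ⟨x, hx, rfl⟩ := Finset.mem_map.1 hy
    change _ ≤ (x : ℕ) ∧ (x : ℕ) < _ ∨ (x : ℕ) + _ < _ at hya
    have hxn := x.2
    have han := a.2
    have key : ∀ j, ((a : ℕ) + j) % (m + 2) = x → a + j • (1 : Fin (m + 2)) ∈ σ := by
      intro j hj
      have : a + j • (1 : Fin (m + 2)) = x := Fin.ext ((val_add_nsmul_one a j).trans hj)
      rwa [this]
    rcases hya with h1 | h1
    · refine ⟨x - a, by omega, key _ ?_⟩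
      rw [Nat.add_sub_cancel' h1.1, Nat.mod_eq_of_lt hxn]
    · refine ⟨x + (m + 2) - a, by omega, key _ ?_⟩
      rw [show (a : ℕ) + (x + (m + 2) - a) = x + (m + 2) by omega, Nat.add_mod_right,
        Nat.mod_eq_of_lt hxn]

end CycleGraph

end PathCycle

theorem mainTheorem5 (K : Type u) [Field K] (n t p d : ℕ) (ht : 2 ≤ t) (htn : t ≤ n)
    (hn : n = (t + 1) * p + d) (hd : d ≤ t) (i : ℤ) :
    (d = 0 ∧ i = 2 * (p : ℤ) - 2 ∧ 0 < p →
      Nonempty (PathCycle.reducedHomology K (PathCycle.complementComplex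
        (PathCycle.pathComplex K (SimpleGraph.cycleGraph n) t)) i ≃ₗ[K] (Fin t → K))) ∧
    (d ≠ 0 ∧ i = 2 * (p : ℤ) - 1 →
      Nonempty (PathCycle.reducedHomology K (PathCycle.complementComplex
        (PathCycle.pathComplex K (SimpleGraph.cycleGraph n) t)) i ≃ₗ[K] K)) ∧
    (¬ (d = 0 ∧ i = 2 * (p : ℤ) - 2 ∧ 0 < p) ∧ ¬ (d ≠ 0 ∧ i = 2 * (p : ℤ) - 1) →
      Subsingleton (PathCycle.reducedHomology K (PathCycle.complementComplex
        (PathCycle.pathComplex K (SimpleGraph.cycleGraph n) t)) i)) := by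
  have : NeZero n := ⟨by omega⟩
  set Δ := PathCycle.complementComplex (PathCycle.pathComplex K (SimpleGraph.cycleGraph n) t)
  have hΔ : ∀ σ, σ ∉ Δ ↔ PathCycle.IsDense n t (PathCycle.values σ) := fun σ =>
    PathCycle.notMem_complementComplex_cycleGraph_iff K ht htn
  have hU : {σ | σ ∉ Δ} = {σ : Finset (Fin n) | PathCycle.IsDense n t (PathCycle.values σ)} :=
    Set.ext hΔ
  obtain ⟨m⟩ : Nonempty (PathCycle.LayeredMatching {σ | σ ∉ Δ} {σ : Finset (Fin n) |
      PathCycle.top (PathCycle.values σ) ≤ PathCycle.pivotMark n t (PathCycle.values σ)}) := by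
    rw [hU]
    exact ⟨PathCycle.denseMatching n t (by omega) htn⟩
  have hcard : ∀ σ ∉ Δ,
      σ ∈ {σ : Finset (Fin n) |
        PathCycle.top (PathCycle.values σ) ≤ PathCycle.pivotMark n t (PathCycle.values σ)} →
      σ.card = if d = 0 then 2 * p else 2 * p + 1 := fun σ h1 h2 =>
    PathCycle.card_of_dense_critical (by omega) htn hn hd ((hΔ σ).1 h1) h2
  have hp : d = 0 → 0 < p := by
    rintro rfl
    rcases Nat.eq_zero_or_pos p with rfl | h
    · omega
    · exact h
  have hpn : 2 * p ≤ n := by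
    have : 2 * p ≤ (t + 1) * p := Nat.mul_le_mul_right p (by omega)
    omega
  -- The natural number is one less than the common size of the critical sets. The truncated `2 * p
  -- - 1` is harmless, as `d = 0` forces `p > 0`.
  have hfin : Module.finrank K
      (PathCycle.reducedHomology K Δ (((if d = 0 then 2 * p - 1 else 2 * p : ℕ) : ℤ) - 1)) =
      if d = 0 then t else 1 := by
    rw [m.finrank_reducedHomology (fun σ h1 h2 => ?_) ?_,
      ← PathCycle.ncard_dense_critical (by omega) htn hn hd]
    · simp only [hΔ, Set.mem_ofPred_eq]
    · rw [Fintype.card_fin]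
      split_ifs <;> omega
    · rw [hcard σ h1 h2]
      split_ifs with h
      · have := hp h
        omega
      · rfl
  refine ⟨?_, ?_, ?_⟩
  · rintro ⟨h0, rfl, h1⟩
    rw [if_pos h0, if_pos h0, show ((2 * p - 1 : ℕ) : ℤ) - 1 = 2 * (p : ℤ) - 2 by omega] at hfin
    exact ⟨LinearEquiv.ofFinrankEq _ _ (by rw [hfin, Module.finrank_fin_fun])⟩
  · rintro ⟨h0, rfl⟩
    rw [if_neg h0, if_neg h0, show ((2 * p : ℕ) : ℤ) - 1 = 2 * (p : ℤ) - 1 by omega] at hfin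
    exact ⟨LinearEquiv.ofFinrankEq _ _ (by rw [hfin, Module.finrank_self])⟩
  · rintro ⟨h1, h2⟩
    refine m.subsingleton_reducedHomology fun σ h3 h4 => ?_
    rw [hcard σ h3 h4]
    split_ifs with h
    · have := hp h
      push_cast
      omega
    · push_cast
      omega
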